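/- Let $\mathcal X,\mathcal Y$ be finite alphabets, $W(y|x)$ a discrete memoryless channel from $\mathcal X$ to $\mathcal Y$, $P\in\mathcal P(\mathcal X)$, and let $q:\mathcal P(\mathcal X\times\mathcal Y)\to\mathbb R$ and $d:\mathcal P(\mathcal X\times\mathcal X)\to\mathbb R$ be continuous (hence bounded); $d$ is not assumed to be symmetric, i.e. $d(P_{X\widetilde X})$ and $d(P_{\widetilde X X})$ may differ. Let $R>0$, $\delta>0$, $\Delta\in\mathbb R$ satisfy $$R\le \min_{P_{X\widetilde X}\in\mathcal P(\mathcal X\times\mathcal X)\,:\,d(P_{X\widetilde X})\le\Delta,\ P_X=P_{\widetilde X}=P} I(X;\widetilde X)-2\delta ,$$ where the minimum over the empty set is $+\infty$. Define $$E_{\mathrm{RGV}}(R,P,W,q,d,\Delta)=\min_{V_{X\widetilde XY}} D(V_{Y|X}\|W|P)+\max\{I(\widetilde X;Y,X)-R,\,0\},$$ the minimum being over all $V_{X\widetilde XY}\in\mathcal P(\mathcal X\times\mathcal X\times\mathcal Y)$ with $V_X=V_{\widetilde X}=P$, $q(V_{\widetilde XY})\ge q(V_{XY})$ and $d(V_{X\widetilde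 X})\ge\Delta$, with value in $[0,+\infty]$. Information quantities are in nats. Then $E_{\mathrm{RGV}}(R,P,W,q,d,\Delta)$ is an achievable error exponent at rate $R$: for every $\epsilon>0$ there is a sequence of codebooks $\mathcal C_n=(\boldsymbol x_1,\dots,\boldsymbol x_{M_n})$ of block length $n$ with $M_n=\lceil e^{n(R-\epsilon)}\rceil$ codewords in $\mathcal X^n$ such that $$\liminf_{n\to\infty}-\frac1n\log P_{\mathrm e}(\mathcal C_n)\ \ge\ E_{\mathrm{RGV}}(R,P,W,q,d,\Delta)-\epsilon ,$$ with $-\log 0=+\infty$. Here $P_{\mathrm e}(\mathcal C_n)$ is the error probability when an equiprobable message $m$ is sent as $\boldsymbol x_m$ over $n$ uses of $W$ and, from the output $\boldsymbol y$, the message is decoded as the index $i$ maximizing $q(\hat P_{\boldsymbol x_i,\boldsymbol y})$, the metric evaluated at the joint empirical distribution of $(\boldsymbol x_i,\boldsymbol y)$; ties for the maximum count as errors. -/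

import Mathlib

open Filter

namespace RGV

/-- The empirical distribution (type) of a sequence of length `n` over a finite alphabet. -/
noncomputable def empirical {A : Type*} [DecidableEq A] {n : ℕ} (s : Fin n → A) : A → ℝ :=
  fun a => ((Finset.univ.filter (fun k => s k = a)).card : ℝ) / n

/-- The joint type of a pair of sequences of length `n`. -/
noncomputable def jointType {A B : Type*} [DecidableEq A] [DecidableEq B] {n : ℕ}
    (s : Fin n → A) (t : Fin n → B) : A × B → ℝ :=
  empirical (fun k => (s k, t k))

/-- The first marginal of a mass function on `A × B`. -/
noncomputable def fstMarginal {A B : Type*} [Fintype B] (V : A × B → ℝ) : A → ℝ :=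
  fun a => ∑ b, V (a, b)

/-- The second marginal of a mass function on `A × B`. -/
noncomputable def sndMarginal {A B : Type*} [Fintype A] (V : A × B → ℝ) : B → ℝ :=
  fun b => ∑ a, V (a, b)

/-- Shannon entropy in nats, `H(V) = ∑ -V(a) log V(a)` with `0 log 0 = 0`. -/
noncomputable def entropy {A : Type*} [Fintype A] (V : A → ℝ) : ℝ :=
  ∑ a, Real.negMulLog (V a)

/-- Mutual information in nats, `I(A;B) = H(A) + H(B) - H(A,B)`. -/
noncomputable def mutualInfo {A B : Type*} [Fintype A] [Fintype B] (V : A × B → ℝ) : ℝ :=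
  entropy (fstMarginal V) + entropy (sndMarginal V) - entropy V

/-- The conditional mass function `V_{B|A}(b|a) = V(a,b) / V_A(a)`
(only relevant where `V_A(a) > 0`). -/
noncomputable def condMass {A B : Type*} [Fintype B] (V : A × B → ℝ) : A → B → ℝ :=
  fun a b => V (a, b) / fstMarginal V a

open Classical in
/-- The conditional divergence `D(U ‖ W | P) = ∑ₓ P(x) ∑_y U(y|x) log (U(y|x) / W(y|x))`, in nats,
with the conventions `0 log (0/w) = 0` and `u log (u/0) = +∞` for `u > 0`. -/
noncomputable def condDivergence {X Y : Type*} [Fintype X] [Fintype Y]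
    (U W : X → Y → ℝ) (P : X → ℝ) : EReal :=
  if ∃ x y, 0 < P x ∧ 0 < U x y ∧ W x y = 0 then ⊤
  else ((∑ x, P x * ∑ y, U x y * Real.log (U x y / W x y) : ℝ) : EReal)

section Triples

/-! Mass functions on `X × X × Y` are joint laws `V` of a triple `(X, X̃, Y)`, in this order. -/

variable {X Y : Type*} [Fintype X] [Fintype Y]

/-- The law of `(X, X̃)`. -/
noncomputable def lawXX' (V : X × X × Y → ℝ) : X × X → ℝ :=
  fun p => ∑ y, V (p.1, p.2, y)

/-- The law of `(X, Y)`. -/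
noncomputable def lawXY (V : X × X × Y → ℝ) : X × Y → ℝ :=
  fun p => ∑ x', V (p.1, x', p.2)

/-- The law of `(X̃, Y)`. -/
noncomputable def lawX'Y (V : X × X × Y → ℝ) : X × Y → ℝ :=
  fun p => ∑ x, V (x, p.1, p.2)

/-- The law of `(X̃, (Y, X))`, regarded as a pair. -/
def lawX'YX (V : X × X × Y → ℝ) : X × (Y × X) → ℝ :=
  fun p => V (p.2.2, p.1, p.2.1)

/-- The constraint set `𝒯_{d,q,P}(Δ)` of the exponent. -/
def constraintSet (P : X → ℝ) (q : (X × Y → ℝ) → ℝ) (d : (X × X → ℝ) → ℝ) (Δ : ℝ) :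
    Set (X × X × Y → ℝ) :=
  {V | V ∈ stdSimplex ℝ (X × X × Y) ∧
    fstMarginal (lawXX' V) = P ∧ sndMarginal (lawXX' V) = P ∧
    q (lawXY V) ≤ q (lawX'Y V) ∧ Δ ≤ d (lawXX' V)}

/-- `E_RGV(R,P,W,q,d,Δ)`: the minimum of `D(V_{Y|X} ‖ W | P) + |I(X̃;Y,X) - R|₊` over the
constraint set, as an extended real. -/
noncomputable def exponent (R : ℝ) (P : X → ℝ) (W : X → Y → ℝ) (q : (X × Y → ℝ) → ℝ)
    (d : (X × X → ℝ) → ℝ) (Δ : ℝ) : EReal :=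
  ⨅ V ∈ constraintSet P q d Δ,
    condDivergence (condMass (lawXY V)) W P + ((max (mutualInfo (lawX'YX V) - R) 0 : ℝ) : EReal)

/-- The minimum of `I(X;X̃)` over the joint laws with both marginals equal to `P` and
`d(P_{XX̃}) ≤ Δ` (`+∞` if there is no such law). -/
noncomputable def minMutualInfo (P : X → ℝ) (d : (X × X → ℝ) → ℝ) (Δ : ℝ) : EReal :=
  ⨅ Q ∈ {Q : X × X → ℝ | Q ∈ stdSimplex ℝ (X × X) ∧
      fstMarginal Q = P ∧ sndMarginal Q = P ∧ d Q ≤ Δ}, ((mutualInfo Q : ℝ) : EReal)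

end Triples

section Coding

variable {X Y : Type*} [Fintype Y] [DecidableEq X] [DecidableEq Y]

open Classical in
/-- The average error probability, over equiprobable messages, of the codebook `c` with `M` codewords
of length `n`, used over the memoryless channel `W` with the maximum metric decoder for the
type-dependent metric `q`. Ties are counted as errors. -/
noncomputable def errorProb (W : X → Y → ℝ) (q : (X × Y → ℝ) → ℝ) {n M : ℕ}
    (c : Fin M → Fin n → X) : ℝ :=
  (1 / (M : ℝ)) * ∑ m, ∑ y : Fin n → Y,
    (∏ k, W (c m k) (y k)) *
      (if ∃ j, j ≠ m ∧ q (jointType (c m) y) ≤ q (jointType (c j) y) then 1 else 0)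

/-- `E` is an achievable error exponent at rate `R` for the channel `W` with decoding metric `q`:
for all `ε > 0` there are codebooks of `exp(n(R-ε))` codewords (rounded up to an integer) of length
`n = 0, 1, 2, …` whose error probabilities `p_n` satisfy `liminf -(1/n) log p_n ≥ E - ε`, where
`-log 0 = +∞`. -/
def IsAchievableExponent (W : X → Y → ℝ) (q : (X × Y → ℝ) → ℝ) (R : ℝ) (E : EReal) : Prop :=
  ∀ ε : ℝ, 0 < ε →
    ∃ c : ∀ n : ℕ, Fin ⌈Real.exp (n * (R - ε))⌉₊ → Fin n → X,
      E - (ε : EReal) ≤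
        liminf (fun n : ℕ => -(ENNReal.log (ENNReal.ofReal (errorProb W q (c n))) / (n : EReal)))
          atTop

end Coding

end RGV

set_option linter.unusedSectionVars false

/-! The proof is random coding over one type class, followed by expurgation. Near `P` there is a
type whose class has `exp (n H)` sequences up to a polynomial factor (`exists_seq_dominant_type`).
Draw `2M` words uniformly from it, and call an ordered pair bad when `d` of its joint type is below
`Δ`. Bad joint types have mutual information at least `R + δ`, so a word has few bad partners on
average (`card_bad_le`).

A competitor that is not bad and beats the sent word has a joint type `V` with the output in the
constraint set. The truncated union bound gives such a `V` at most `exp (-n (D + |I - R|₊))` up to a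
polynomial (`sum_prob_min_le`), and there are polynomially many `V`. By averaging, half of the words
of some code have no bad partner and a small error (`exists_expurgated_code`). Badness is only
tested with the kept word in first place, so `d` need not be symmetric.

The types used only converge to `P`. Compactness carries both the rate condition and any strict
lower bound on the exponent from `P` to nearby input laws (`eventually_diag_notMem_image`). No law
has to be approximated by types, since only lower bounds on the objective are needed. -/

namespace RGV


/-! ### Entropy and marginals -/

section Marginals

variable {A B : Type*} [Fintype A] [Fintype B]

lemma entropy_comp_equiv (e : B ≃ A) (V : A → ℝ) : entropy (V ∘ e) = entropy V :=
  Equiv.sum_comp e fun a => Real.negMulLog (V a)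

lemma fstMarginal_comp_swap (Q : A × B → ℝ) :
    fstMarginal (Q ∘ Prod.swap) = sndMarginal Q := rfl

lemma le_fstMarginal {Q : A × B → ℝ} (hQ : ∀ p, 0 ≤ Q p) (a : A) (b : B) :
    Q (a, b) ≤ fstMarginal Q a :=
  Finset.single_le_sum (f := fun b => Q (a, b)) (fun _ _ => hQ _) (Finset.mem_univ b)

lemma sum_mul_log_fstMarginal (Q : A × B → ℝ) :
    ∑ p : A × B, Q p * Real.log (fstMarginal Q p.1) = -entropy (fstMarginal Q) := by
  rw [Fintype.sum_prod_type]
  simp only [← Finset.sum_mul, entropy, Real.negMulLog, ← Finset.sum_neg_distrib]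
  refine Finset.sum_congr rfl fun a _ => ?_
  simp [fstMarginal]

end Marginals

/-! ### The method of types -/

section Types

variable {A B : Type*} [Fintype A] [Fintype B] [DecidableEq A] [DecidableEq B] {n : ℕ}

lemma empirical_eq_sum (s : Fin n → A) (a : A) :
    empirical s a = (∑ k, if s k = a then (1 : ℝ) else 0) / n := by
  simp [empirical]

/-- Averaging against the empirical distribution is averaging along the sequence. -/
lemma sum_empirical_mul (s : Fin n → A) (g : A → ℝ) :
    ∑ a, empirical s a * g a = (∑ k, g (s k)) / n := by
  simp only [empirical_eq_sum, div_mul_eq_mul_div, Finset.sum_mul, ← Finset.sum_div]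
  rw [Finset.sum_comm]
  simp

lemma empirical_nonneg (s : Fin n → A) (a : A) : 0 ≤ empirical s a := by
  unfold empirical; positivity

lemma empirical_pos (s : Fin n → A) (k : Fin n) : 0 < empirical s (s k) := by
  have hn : 0 < n := k.pos
  have : 0 < (Finset.univ.filter (fun j => s j = s k)).card :=
    Finset.card_pos.2 ⟨k, by simp⟩
  unfold empirical; positivity

lemma exists_of_empirical_pos {s : Fin n → A} {a : A} (h : 0 < empirical s a) :
    ∃ k, s k = a := by
  by_contra! hc
  simp [empirical, hc] at h

lemma empirical_mem_stdSimplex (hn : 0 < n) (s : Fin n → A) :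
    empirical s ∈ stdSimplex ℝ A := by
  refine ⟨empirical_nonneg s, ?_⟩
  have := sum_empirical_mul s (fun _ => 1)
  have hn' : (n : ℝ) ≠ 0 := by positivity
  simpa [hn'] using this

lemma fstMarginal_jointType (s : Fin n → A) (t : Fin n → B) :
    fstMarginal (jointType s t) = empirical s := by
  ext a
  simp only [fstMarginal, jointType, empirical_eq_sum, ← Finset.sum_div]
  rw [Finset.sum_comm]
  simp [Prod.mk.injEq, ite_and]

lemma sndMarginal_jointType (s : Fin n → A) (t : Fin n → B) :
    sndMarginal (jointType s t) = empirical t := by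
  ext a
  simp only [sndMarginal, jointType, empirical_eq_sum, ← Finset.sum_div]
  rw [Finset.sum_comm]
  simp [Prod.mk.injEq, ite_and]

lemma jointType_pos (s : Fin n → A) (t : Fin n → B) (k : Fin n) :
    0 < jointType s t (s k, t k) :=
  empirical_pos (fun k => (s k, t k)) k

lemma jointType_swap (s : Fin n → A) (t : Fin n → B) :
    jointType s t ∘ Prod.swap = jointType t s := by
  ext ⟨b, a⟩
  simp [jointType, empirical_eq_sum, Prod.mk.injEq, and_comm]

lemma prod_eq_exp (s : Fin n → A) (U : A → ℝ) (h : ∀ k, 0 < U (s k)) :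
    ∏ k, U (s k) = Real.exp (n * ∑ a, empirical s a * Real.log (U a)) := by
  rw [sum_empirical_mul]
  rcases Nat.eq_zero_or_pos n with rfl | hn
  · simp
  · rw [mul_div_cancel₀ _ (by positivity), Real.exp_sum]
    exact Finset.prod_congr rfl fun k _ => (Real.exp_log (h k)).symm

/-- The type class of `s` has at most `exp (n H)` elements. -/
lemma card_typeClass_le (s : Fin n → A) :
    ((Finset.univ.filter fun t : Fin n → A => empirical t = empirical s).card : ℝ)
      ≤ Real.exp (n * entropy (empirical s)) := by
  rcases Nat.eq_zero_or_pos n with rfl | hn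
  · have := Finset.card_filter_le (Finset.univ : Finset (Fin 0 → A))
      (fun t => empirical t = empirical s)
    simp only [Finset.card_univ, Fintype.card_unique] at this
    simpa using this
  set Q := empirical s with hQ
  -- Under the i.i.d. law `Q` each member of the class has probability exactly `exp (-n H(Q))`, and
  -- the total is at most `1`.
  have hsum : ∑ t : Fin n → A, ∏ k, Q (t k) = 1 := by
    rw [← Fintype.prod_sum (fun (_ : Fin n) a => Q a)]
    simp [(empirical_mem_stdSimplex hn s).2, hQ]
  have hle : ∑ t ∈ Finset.univ.filter (fun t : Fin n → A => empirical t = Q), ∏ k, Q (t k)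
      ≤ 1 := by
    rw [← hsum]
    exact Finset.sum_le_sum_of_subset_of_nonneg (Finset.filter_subset _ _)
      fun t _ _ => Finset.prod_nonneg fun k _ => empirical_nonneg s _
  have heq : ∀ t ∈ Finset.univ.filter (fun t : Fin n → A => empirical t = Q),
      ∏ k, Q (t k) = Real.exp (-(n * entropy Q)) := by
    intro t ht
    have ht : empirical t = Q := by simpa using ht
    rw [prod_eq_exp t Q (fun k => by rw [← ht]; exact empirical_pos t k), ht]
    congr 1
    simp [entropy, Real.negMulLog]
  rw [Finset.sum_congr rfl heq, Finset.sum_const, nsmul_eq_mul, Real.exp_neg,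
    ← div_eq_mul_inv, div_le_one (Real.exp_pos _)] at hle
  exact hle

/-- The conditional type class has at most `exp (n H(B|A))` elements. -/
lemma card_condTypeClass_le (z : Fin n → A) (Q : A × B → ℝ) :
    ((Finset.univ.filter fun w : Fin n → B => jointType z w = Q).card : ℝ)
      ≤ Real.exp (n * (entropy Q - entropy (fstMarginal Q))) := by
  rcases (Finset.univ.filter fun w : Fin n → B => jointType z w = Q).eq_empty_or_nonempty with
    h | ⟨w₀, hw₀⟩
  · rw [h]; simp [Real.exp_nonneg]
  have hw₀ : jointType z w₀ = Q := by simpa using hw₀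
  have hQ0 : ∀ p, 0 ≤ Q p := fun p => by rw [← hw₀]; exact empirical_nonneg _ p
  have hfst : fstMarginal Q = empirical z := by rw [← hw₀, fstMarginal_jointType]
  have hpos : ∀ k, 0 < fstMarginal Q (z k) := fun k => by rw [hfst]; exact empirical_pos z k
  -- The same argument with the memoryless kernel `Q_{B|A}` driven by `z`.
  have hsum : ∑ w : Fin n → B, ∏ k, Q (z k, w k) / fstMarginal Q (z k) = 1 := by
    rw [← Fintype.prod_sum (fun (k : Fin n) b => Q (z k, b) / fstMarginal Q (z k))]
    refine Finset.prod_eq_one fun k _ => ?_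
    rw [← Finset.sum_div]
    exact div_self (hpos k).ne'
  have hle : ∑ w ∈ Finset.univ.filter (fun w : Fin n → B => jointType z w = Q),
      ∏ k, Q (z k, w k) / fstMarginal Q (z k) ≤ 1 := by
    rw [← hsum]
    exact Finset.sum_le_sum_of_subset_of_nonneg (Finset.filter_subset _ _)
      fun t _ _ => Finset.prod_nonneg fun k _ => div_nonneg (hQ0 _) (hpos k).le
  have heq : ∀ w ∈ Finset.univ.filter (fun w : Fin n → B => jointType z w = Q),
      ∏ k, Q (z k, w k) / fstMarginal Q (z k)
        = Real.exp (-(n * (entropy Q - entropy (fstMarginal Q)))) := by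
    intro w hw
    have hw : jointType z w = Q := by simpa using hw
    have hQp : ∀ k, 0 < Q (z k, w k) := fun k => by rw [← hw]; exact jointType_pos z w k
    rw [prod_eq_exp (fun k => (z k, w k)) (fun p => Q p / fstMarginal Q p.1)
      (fun k => div_pos (hQp k) (hpos k))]
    change Real.exp (n * ∑ p, jointType z w p * _) = _
    rw [hw, ← mul_neg, neg_sub, sub_eq_add_neg, ← neg_neg (entropy (fstMarginal Q)),
      ← sum_mul_log_fstMarginal]
    congr 2
    rw [entropy, ← Finset.sum_neg_distrib, ← Finset.sum_neg_distrib, ← Finset.sum_add_distrib]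
    refine Finset.sum_congr rfl fun p _ => ?_
    rcases (hQ0 p).eq_or_lt with h0 | h0
    · simp [← h0]
    · rw [Real.log_div h0.ne' (h0.trans_le (le_fstMarginal hQ0 p.1 p.2)).ne', Real.negMulLog]
      ring
  rw [Finset.sum_congr rfl heq, Finset.sum_const, nsmul_eq_mul, Real.exp_neg,
    ← div_eq_mul_inv, div_le_one (Real.exp_pos _)] at hle
  exact hle

lemma card_condTypeClass_le' (z : Fin n → A) (Q : B × A → ℝ) :
    ((Finset.univ.filter fun w : Fin n → B => jointType w z = Q).card : ℝ)
      ≤ Real.exp (n * (entropy (fstMarginal Q) - mutualInfo Q)) := by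
  have h := card_condTypeClass_le z (Q ∘ Prod.swap)
  rw [fstMarginal_comp_swap, show entropy (Q ∘ Prod.swap) = entropy Q from
    entropy_comp_equiv (Equiv.prodComm A B) Q] at h
  have hs : (Finset.univ.filter fun w : Fin n → B => jointType z w = Q ∘ Prod.swap)
      = Finset.univ.filter fun w : Fin n → B => jointType w z = Q := by
    refine Finset.filter_congr fun w _ => ?_
    rw [← jointType_swap w z]
    exact (Prod.swap_bijective.surjective.injective_comp_right).eq_iff
  rw [hs] at h
  refine h.trans_eq ?_
  rw [mutualInfo]
  ring_nf

open Classical in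
/-- The set of all types of sequences of length `n`. -/
noncomputable def typesFinset (A : Type*) [Fintype A] [DecidableEq A] (n : ℕ) :
    Finset (A → ℝ) :=
  Finset.univ.image (empirical : (Fin n → A) → A → ℝ)

lemma empirical_mem_typesFinset (s : Fin n → A) : empirical s ∈ typesFinset A n := by
  simp [typesFinset]

lemma card_typesFinset_le : (typesFinset A n).card ≤ (n + 1) ^ Fintype.card A := by
  classical
  have : typesFinset A n ⊆ (Finset.univ : Finset (A → Fin (n + 1))).image
      (fun c a => ((c a : ℕ) : ℝ) / n) := by
    intro Q hQ
    obtain ⟨s, -, rfl⟩ := Finset.mem_image.1 hQ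
    refine Finset.mem_image.2 ⟨fun a => ⟨(Finset.univ.filter (fun k => s k = a)).card, ?_⟩,
      Finset.mem_univ _, rfl⟩
    exact Nat.lt_succ_of_le ((Finset.card_filter_le _ _).trans (by simp))
  refine (Finset.card_le_card this).trans (Finset.card_image_le.trans ?_)
  simp

end Types


/-! ### A large type class near a given law -/

section DominantType

variable {A : Type*} [Fintype A] [DecidableEq A]

/-- The divergence dominates the squared Hellinger distance. -/
lemma sum_sq_sqrt_sub_le {P Q : A → ℝ} (hP : P ∈ stdSimplex ℝ A) (hQ : Q ∈ stdSimplex ℝ A)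
    (hac : ∀ a, 0 < Q a → 0 < P a) :
    ∑ a, (√(Q a) - √(P a)) ^ 2 ≤ -entropy Q - ∑ a, Q a * Real.log (P a) := by
  -- The correction `P a - Q a` sums to zero and makes the inequality hold termwise, by `log t ≤ t -
  -- 1` at `t = √P / √Q`.
  have key : ∀ a, (√(Q a) - √(P a)) ^ 2 - (P a - Q a)
      ≤ -Real.negMulLog (Q a) - Q a * Real.log (P a) := by
    intro a
    rcases (hQ.1 a).eq_or_lt with h0 | h0
    · simp [← h0, Real.sq_sqrt (hP.1 a)]
    · have hp := hac a h0
      have hsq := Real.sqrt_pos.2 h0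
      have hsp := Real.sqrt_pos.2 hp
      have h1 := Real.log_le_sub_one_of_pos (div_pos hsp hsq)
      rw [Real.log_div hsp.ne' hsq.ne', Real.log_sqrt h0.le, Real.log_sqrt hp.le] at h1
      have h2 := mul_le_mul_of_nonneg_left h1 (mul_nonneg zero_le_two h0.le)
      have h3 : Q a * (√(P a) / √(Q a)) = √(Q a) * √(P a) := by
        rw [← mul_div_assoc, div_eq_iff hsq.ne']
        nlinarith [Real.mul_self_sqrt h0.le]
      have h4 := Real.sq_sqrt h0.le
      have h5 := Real.sq_sqrt hp.le
      simp only [Real.negMulLog]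
      nlinarith
  have := Finset.sum_le_sum fun a (_ : a ∈ Finset.univ) => key a
  simp only [Finset.sum_sub_distrib, Finset.sum_neg_distrib, hP.2, hQ.2, sub_self, sub_zero]
    at this
  simpa only [entropy, Finset.sum_sub_distrib, Finset.sum_neg_distrib] using this

/-- The most likely type of a sequence drawn from `P` has a type class of nearly `exp (n H)` elements
and is close to `P`. -/
lemma exists_dominant_type {P : A → ℝ} (hP : P ∈ stdSimplex ℝ A) {n : ℕ} (hn : 0 < n) :
    ∃ s : Fin n → A,
      Real.exp (n * entropy (empirical s)) ≤ ((n : ℝ) + 1) ^ Fintype.card A *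
        (Finset.univ.filter fun t : Fin n → A => empirical t = empirical s).card ∧
      ∀ a, (√(empirical s a) - √(P a)) ^ 2 ≤ Fintype.card A * Real.log (n + 1) / n := by
  classical
  set L : ℝ := ((n : ℝ) + 1) ^ Fintype.card A with hL
  have hLpos : 0 < L := by positivity
  have hnpos : (0 : ℝ) < n := by exact_mod_cast hn
  have hsum : ∑ t : Fin n → A, ∏ k, P (t k) = 1 := by
    rw [← Fintype.prod_sum (fun (_ : Fin n) a => P a)]
    simp [hP.2]
  rw [← Finset.sum_fiberwise_of_maps_to (t := typesFinset A n)
    (fun t _ => empirical_mem_typesFinset t)] at hsum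
  -- Pigeonhole: at most `L` types share the total probability `1`.
  obtain ⟨Q, -, hQ⟩ : ∃ Q ∈ typesFinset A n, 1 / L ≤
      ∑ t ∈ Finset.univ.filter (fun t : Fin n → A => empirical t = Q), ∏ k, P (t k) := by
    by_contra! hc
    have hne : (typesFinset A n).Nonempty := by
      by_contra hne
      rw [Finset.not_nonempty_iff_eq_empty] at hne
      simp [hne] at hsum
    have h1 := Finset.sum_lt_sum_of_nonempty hne hc
    rw [hsum, Finset.sum_const, nsmul_eq_mul, mul_one_div, lt_div_iff₀ hLpos, one_mul] at h1
    have : ((typesFinset A n).card : ℝ) ≤ L := by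
      rw [hL]; exact_mod_cast card_typesFinset_le
    linarith
  have hLinv : 0 < 1 / L := by positivity
  obtain ⟨s, hs, hspos⟩ : ∃ s ∈ Finset.univ.filter (fun t : Fin n → A => empirical t = Q),
      0 < ∏ k, P (s k) := by
    by_contra! hc
    have := Finset.sum_nonpos hc
    linarith
  have hs : empirical s = Q := by simpa using hs
  subst hs
  have hPk : ∀ k, 0 < P (s k) := fun k =>
    (hP.1 _).lt_of_ne' fun h0 => hspos.ne' (Finset.prod_eq_zero (Finset.mem_univ k) h0)
  have hac : ∀ a, 0 < empirical s a → 0 < P a := fun a ha => by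
    obtain ⟨k, rfl⟩ := exists_of_empirical_pos ha
    exact hPk k
  have hval : ∀ t ∈ Finset.univ.filter (fun t : Fin n → A => empirical t = empirical s),
      ∏ k, P (t k) = Real.exp (n * ∑ a, empirical s a * Real.log (P a)) := by
    intro t ht
    have ht : empirical t = empirical s := by simpa using ht
    rw [prod_eq_exp t P fun k => hac _ (by rw [← ht]; exact empirical_pos t k), ht]
  rw [Finset.sum_congr rfl hval, Finset.sum_const, nsmul_eq_mul, div_le_iff₀ hLpos] at hQ
  set N : ℝ := ((Finset.univ.filter fun t : Fin n → A => empirical t = empirical s).card : ℝ)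
  set S := ∑ a, empirical s a * Real.log (P a)
  have hHel := sum_sq_sqrt_sub_le hP (empirical_mem_stdSimplex hn s) hac
  have hHel0 : 0 ≤ ∑ a, (√(empirical s a) - √(P a)) ^ 2 :=
    Finset.sum_nonneg fun _ _ => sq_nonneg _
  have hN0 : 0 ≤ N := Nat.cast_nonneg _
  -- The class has probability `N exp (n S) ≥ 1 / L`. Nonnegative divergence, `S ≤ -H`, bounds `N`
  -- below; `N ≤ exp (n H)` bounds the divergence `-H - S` above by `log L / n`.
  refine ⟨s, ?_, fun a => ?_⟩
  · have h1 : Real.exp (n * S) ≤ Real.exp (-(n * entropy (empirical s))) := by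
      rw [Real.exp_le_exp, ← mul_neg]
      exact mul_le_mul_of_nonneg_left (by linarith) hnpos.le
    have h2 : 1 ≤ N * Real.exp (-(n * entropy (empirical s))) * L :=
      hQ.trans (mul_le_mul_of_nonneg_right (mul_le_mul_of_nonneg_left h1 hN0) hLpos.le)
    rw [Real.exp_neg] at h2
    have h3 := Real.exp_pos (n * entropy (empirical s))
    field_simp at h2
    linarith
  · have h1 := card_typeClass_le s
    have h2 : 1 ≤ Real.exp (n * (entropy (empirical s) + S)) * L := by
      refine hQ.trans ?_
      rw [mul_add, Real.exp_add]
      gcongr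
    have h3 := Real.log_nonneg h2
    rw [Real.log_mul (Real.exp_pos _).ne' hLpos.ne', Real.log_exp, hL, Real.log_pow] at h3
    rw [le_div_iff₀ hnpos]
    have h4 := Finset.single_le_sum (f := fun a => (√(empirical s a) - √(P a)) ^ 2)
      (fun _ _ => sq_nonneg _) (Finset.mem_univ a)
    nlinarith

lemma tendsto_pow_mul_exp_neg (K : ℕ) {b : ℝ} (hb : 0 < b) :
    Tendsto (fun n : ℕ => ((n : ℝ) + 1) ^ K * Real.exp (-(n * b))) atTop (nhds 0) := by
  have hx : Tendsto (fun n : ℕ => ((n : ℝ) + 1) * b) atTop atTop :=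
    (tendsto_atTop_add_const_right _ 1 tendsto_natCast_atTop_atTop).atTop_mul_const hb
  have h1 := ((Real.tendsto_pow_mul_exp_neg_atTop_nhds_zero K).comp hx).mul_const
    (Real.exp b / b ^ K)
  rw [zero_mul] at h1
  refine h1.congr fun n => ?_
  simp only [Function.comp_apply, mul_pow]
  rw [show -(n * b) = -((n + 1) * b) + b by ring, Real.exp_add]
  field_simp

lemma tendsto_log_div (C : ℝ) :
    Tendsto (fun n : ℕ => C * Real.log ((n : ℝ) + 1) / n) atTop (nhds 0) := by
  have hx : Tendsto (fun n : ℕ => (n : ℝ) + 1) atTop atTop :=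
    tendsto_atTop_add_const_right _ 1 tendsto_natCast_atTop_atTop
  have h1 := ((Real.tendsto_pow_log_div_mul_add_atTop 1 (-1) 1 one_ne_zero).comp hx).const_mul C
  rw [mul_zero] at h1
  refine h1.congr fun n => ?_
  simp [mul_div_assoc]

/-- Sequences whose types are close to `P` and whose type classes are large. -/
lemma exists_seq_dominant_type {P : A → ℝ} (hP : P ∈ stdSimplex ℝ A) :
    ∃ s : ∀ n : ℕ, Fin n → A,
      Tendsto (fun n => empirical (s n)) atTop (nhds P) ∧
      ∀ n, 0 < n → Real.exp (n * entropy (empirical (s n))) ≤ ((n : ℝ) + 1) ^ Fintype.card A *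
        (Finset.univ.filter fun t : Fin n → A => empirical t = empirical (s n)).card := by
  have h : ∀ n : ℕ, ∃ s : Fin n → A, 0 < n →
      (Real.exp (n * entropy (empirical s)) ≤ ((n : ℝ) + 1) ^ Fintype.card A *
        (Finset.univ.filter fun t : Fin n → A => empirical t = empirical s).card ∧
      ∀ a, (√(empirical s a) - √(P a)) ^ 2 ≤ Fintype.card A * Real.log (n + 1) / n) := by
    intro n
    rcases Nat.eq_zero_or_pos n with rfl | hn
    · exact ⟨Fin.elim0, fun h => absurd h (lt_irrefl _)⟩
    · obtain ⟨s, hs⟩ := exists_dominant_type hP hn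
      exact ⟨s, fun _ => hs⟩
  choose s hs using h
  refine ⟨s, tendsto_pi_nhds.2 fun a => ?_, fun n hn => (hs n hn).1⟩
  have h1 : Tendsto (fun n => (√(empirical (s n) a) - √(P a)) ^ 2) atTop (nhds 0) :=
    squeeze_zero' (Eventually.of_forall fun _ => sq_nonneg _)
      ((eventually_gt_atTop 0).mono fun n hn => (hs n hn).2 a) (tendsto_log_div _)
  have h2 : Tendsto (fun n => √(empirical (s n) a) - √(P a)) atTop (nhds 0) := by
    have := (Real.continuous_sqrt.tendsto 0).comp h1
    simp only [Function.comp_def, Real.sqrt_sq_eq_abs, Real.sqrt_zero] at this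
    exact (tendsto_zero_iff_abs_tendsto_zero _).2 this
  have h3 := ((h2.add_const (√(P a))).pow 2)
  simpa [Real.sq_sqrt (hP.1 a), Real.sq_sqrt (empirical_nonneg (s _) a)] using h3

end DominantType

/-! ### Random codes and expurgation -/

section Expurgation

variable {ι T : Type*} [Fintype ι] [DecidableEq ι] [Fintype T]

/-- Each coordinate of a uniformly random code is uniform on `T`; probabilities are expressed by
counting codes. -/
lemma card_filter_apply_mul (S : T → Prop) [DecidablePred S] (i : ι) :
    ((Finset.univ.filter fun c : ι → T => S (c i)).card : ℝ) * Fintype.card T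
      = (Fintype.card T : ℝ) ^ Fintype.card ι * (Finset.univ.filter S).card := by
  have h := Fintype.sum_piFinset_apply (fun t => if S t then (1 : ℝ) else 0)
    (Finset.univ : Finset T) i
  rw [Fintype.piFinset_univ, Finset.sum_boole, Finset.sum_boole, nsmul_eq_mul,
    Finset.card_univ] at h
  rw [h]
  have : Fintype.card ι = (Fintype.card ι - 1) + 1 :=
    (Nat.sub_add_cancel (Fintype.card_pos_iff.2 ⟨i⟩)).symm
  rw [this, pow_succ]
  push_cast [Nat.add_sub_cancel]
  ring

lemma card_filter_exists_le [Nonempty T] (S : T → Prop) [DecidablePred S] :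
    ((Finset.univ.filter fun c : ι → T => ∃ i, S (c i)).card : ℝ)
      ≤ (Fintype.card T : ℝ) ^ Fintype.card ι *
        min 1 (Fintype.card ι * ((Finset.univ.filter S).card : ℝ) / Fintype.card T) := by
  have hT : (0 : ℝ) < Fintype.card T := by exact_mod_cast Fintype.card_pos
  rw [mul_min_of_nonneg _ _ (by positivity), mul_one, le_min_iff]
  constructor
  · have := Finset.card_filter_le (Finset.univ : Finset (ι → T)) (fun c => ∃ i, S (c i))
    rw [Finset.card_univ, Fintype.card_fun] at this
    exact_mod_cast this
  · rw [← mul_div_assoc, le_div_iff₀ hT]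
    classical
    have h1 : (Finset.univ.filter fun c : ι → T => ∃ i, S (c i)) ⊆
        Finset.univ.biUnion fun i => Finset.univ.filter fun c : ι → T => S (c i) := by
      intro c hc
      simpa using hc
    have h2 : ((Finset.univ.filter fun c : ι → T => ∃ i, S (c i)).card : ℝ) ≤
        ∑ i, ((Finset.univ.filter fun c : ι → T => S (c i)).card : ℝ) := by
      exact_mod_cast (Finset.card_le_card h1).trans Finset.card_biUnion_le
    refine (mul_le_mul_of_nonneg_right h2 hT.le).trans_eq ?_
    rw [Finset.sum_mul, Finset.sum_congr rfl fun i _ => card_filter_apply_mul S i,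
      Finset.sum_const, Finset.card_univ, nsmul_eq_mul]
    ring

open Classical in
/-- The union bound for the word `c m` of a random code `c`, with the bound truncated at `1`. -/
lemma sum_code_le [Nonempty T] {Z : Type*} [Fintype Z] (w : T → Z → ℝ) (hw : ∀ t z, 0 ≤ w t z)
    (r : T → T → Z → Prop) {B : ℝ}
    (hB : ∀ t, ∑ z, w t z * min 1 (Fintype.card ι *
      ((Finset.univ.filter fun t' => r t t' z).card : ℝ) / Fintype.card T) ≤ B) (m : ι) :
    ∑ c : ι → T, ∑ z, w (c m) z * (if ∃ j, j ≠ m ∧ r (c m) (c j) z then 1 else 0)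
      ≤ (Fintype.card T : ℝ) ^ Fintype.card ι * B := by
  have hT : (0 : ℝ) < Fintype.card T := by exact_mod_cast Fintype.card_pos
  set κ := {j // j ≠ m}
  have hκ : Fintype.card ι = Fintype.card κ + 1 := by
    have : 0 < Fintype.card ι := Fintype.card_pos_iff.2 ⟨m⟩
    simp only [κ, ne_eq, Fintype.card_subtype_compl, Fintype.card_subtype_eq]
    omega
  -- Freeze the word `m` at `t`; the remaining words range freely over `κ → T`, where the union
  -- bound applies.
  rw [← Equiv.sum_comp (Equiv.funSplitAt m T).symm, Fintype.sum_prod_type]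
  have hx : ∀ t : T, ∑ c : κ → T, ∑ z, w ((Equiv.funSplitAt m T).symm (t, c) m) z *
      (if ∃ j, j ≠ m ∧ r ((Equiv.funSplitAt m T).symm (t, c) m)
        ((Equiv.funSplitAt m T).symm (t, c) j) z then 1 else 0)
      ≤ (Fintype.card T : ℝ) ^ Fintype.card κ * B := by
    intro t
    have hif : ∀ (c : κ → T) z, (∃ j, j ≠ m ∧ r ((Equiv.funSplitAt m T).symm (t, c) m)
        ((Equiv.funSplitAt m T).symm (t, c) j) z) ↔ ∃ j : κ, r t (c j) z := by
      intro c z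
      simp only [Equiv.funSplitAt_symm_apply, κ, Subtype.exists]
      refine exists_congr fun j => ?_
      constructor
      · rintro ⟨h, h'⟩
        exact ⟨h, by simpa [h] using h'⟩
      · rintro ⟨h, h'⟩
        exact ⟨h, by simpa [h] using h'⟩
    have hm : ∀ c : κ → T, (Equiv.funSplitAt m T).symm (t, c) m = t := by
      intro c; simp [Equiv.funSplitAt_symm_apply]
    simp only [hif]
    simp only [hm]
    rw [Finset.sum_comm]
    refine le_trans ?_ (mul_le_mul_of_nonneg_left (hB t) (by positivity))
    rw [Finset.mul_sum]
    refine Finset.sum_le_sum fun z _ => ?_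
    rw [← Finset.mul_sum, Finset.sum_boole, mul_left_comm]
    refine mul_le_mul_of_nonneg_left ?_ (hw t z)
    refine (card_filter_exists_le (ι := κ) (fun t' => r t t' z)).trans ?_
    have : (Fintype.card κ : ℝ) ≤ Fintype.card ι := by rw [hκ]; push_cast; linarith
    gcongr
  refine (Finset.sum_le_sum fun t _ => hx t).trans_eq ?_
  rw [Finset.sum_const, Finset.card_univ, nsmul_eq_mul, hκ, pow_succ]
  ring

open Classical in
/-- Random coding with expurgation: half of the words of some code of twice the size are in no `bad`
pair and have a small error. -/
lemma exists_expurgated_code [Nonempty T] {Z : Type*} [Fintype Z] (w : T → Z → ℝ)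
    (hw : ∀ t z, 0 ≤ w t z) (bad : T → T → Prop) (conf : T → T → Z → Prop) (M : ℕ) {B : ℝ}
    (hB0 : 0 < B)
    (hbad : ∀ t, (2 * M : ℝ) * ((Finset.univ.filter fun t' => bad t t').card : ℝ) /
      Fintype.card T ≤ 1 / 4)
    (hB : ∀ t, ∑ z, w t z * min 1 ((2 * M : ℝ) *
      ((Finset.univ.filter fun t' => ¬ bad t t' ∧ conf t t' z).card : ℝ) / Fintype.card T) ≤ B) :
    ∃ c : Fin M → T, ∀ m, ∑ z, w (c m) z *
      (if ∃ j, j ≠ m ∧ conf (c m) (c j) z then 1 else 0) ≤ 4 * B := by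
  have hT : (0 : ℝ) < Fintype.card T := by exact_mod_cast Fintype.card_pos
  set N : ℝ := (Fintype.card T : ℝ) ^ (2 * M) with hN
  have hNpos : 0 < N := by positivity
  set e : (Fin (2 * M) → T) → Fin (2 * M) → ℝ := fun c m => ∑ z, w (c m) z *
    (if ∃ j, j ≠ m ∧ ¬ bad (c m) (c j) ∧ conf (c m) (c j) z then 1 else 0) with he
  set b : (Fin (2 * M) → T) → Fin (2 * M) → ℝ := fun c m =>
    if ∃ j, j ≠ m ∧ bad (c m) (c j) then 1 else 0 with hb
  have he0 : ∀ c m, 0 ≤ e c m := fun c m => Finset.sum_nonneg fun z _ =>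
    mul_nonneg (hw _ _) (by split_ifs <;> norm_num)
  have hb0 : ∀ c m, 0 ≤ b c m := fun c m => by simp only [hb]; split_ifs <;> norm_num
  have hsum_e : ∀ m, ∑ c, e c m ≤ N * B := fun m => by
    have := sum_code_le (ι := Fin (2 * M)) w hw (fun t t' z => ¬ bad t t' ∧ conf t t' z)
      (B := B) (fun t => by
        refine le_trans (le_of_eq ?_) (hB t)
        simp only [Fintype.card_fin, Nat.cast_mul, Nat.cast_ofNat]
        congr!) m
    rw [Fintype.card_fin] at this
    convert this using 8
  -- A one-point output space turns the union bound into a count of codes in which `m` has a bad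
  -- partner.
  have hsum_b : ∀ m, ∑ c, b c m ≤ N * (1 / 4) := fun m => by
    have := sum_code_le (ι := Fin (2 * M)) (Z := Unit) (fun _ _ => 1) (fun _ _ => zero_le_one)
      (fun t t' _ => bad t t') (B := 1 / 4)
      (fun t => by
        simp only [one_mul, Finset.univ_unique, Finset.sum_singleton]
        exact (min_le_right _ _).trans (by simpa using hbad t)) m
    simp only [one_mul, Finset.univ_unique, Finset.sum_singleton, Fintype.card_fin] at this
    convert this using 3
  -- Each word contributes at most `1/4 + 1/4` on average, hence `M` over `2M` words.
  obtain ⟨c, -, hc⟩ : ∃ c ∈ (Finset.univ : Finset (Fin (2 * M) → T)),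
      ∑ m, (e c m / (4 * B) + b c m) ≤ M := by
    refine Finset.exists_le_of_sum_le Finset.univ_nonempty ?_
    rw [Finset.sum_comm, Finset.sum_const, Finset.card_univ, nsmul_eq_mul, Fintype.card_fun,
      Fintype.card_fin]
    have h1 : ∀ m ∈ (Finset.univ : Finset (Fin (2 * M))),
        ∑ c, (e c m / (4 * B) + b c m) ≤ N * (1 / 2) := by
      intro m _
      rw [Finset.sum_add_distrib, ← Finset.sum_div]
      have : (∑ c, e c m) / (4 * B) ≤ N * (1 / 4) := by
        rw [div_le_iff₀ (by positivity)]
        linarith [hsum_e m]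
      linarith [hsum_b m]
    refine (Finset.sum_le_sum h1).trans_eq ?_
    simp [hN]
    ring
  -- Since `b` is `0` or `1`, a value below `1` forces both `b = 0` and `e < 4B`. At most `M` words
  -- fail this.
  set G := Finset.univ.filter fun m => e c m / (4 * B) + b c m < 1 with hG
  have hcard : M ≤ G.card := by
    have h1 : ((Finset.univ.filter fun m => ¬ e c m / (4 * B) + b c m < 1).card : ℝ) ≤ M := by
      refine le_trans ?_ hc
      rw [Finset.cast_card, Finset.sum_filter]
      refine Finset.sum_le_sum fun m _ => ?_
      split_ifs with h
      · exact add_nonneg (div_nonneg (he0 _ _) (by positivity)) (hb0 _ _)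
      · exact not_lt.1 h
    have h2 := Finset.card_filter_add_card_filter_not
      (s := (Finset.univ : Finset (Fin (2 * M)))) (fun m => e c m / (4 * B) + b c m < 1)
    rw [Finset.card_univ, Fintype.card_fin] at h2
    have h3 : (Finset.univ.filter fun m => ¬ e c m / (4 * B) + b c m < 1).card ≤ M := by
      exact_mod_cast h1
    have h4 : G.card + (Finset.univ.filter fun m => ¬ e c m / (4 * B) + b c m < 1).card = 2 * M := by
      convert h2
    omega
  obtain ⟨G', hG', hcard'⟩ := Finset.exists_subset_card_eq hcard
  set φ := G'.orderEmbOfFin hcard'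
  refine ⟨fun i => c (φ i), fun i => ?_⟩
  have hi : e c (φ i) / (4 * B) + b c (φ i) < 1 := by
    simpa [hG] using hG' (G'.orderEmbOfFin_mem hcard' i)
  have hnb : ∀ j, j ≠ φ i → ¬ bad (c (φ i)) (c j) := by
    intro j hj hbj
    have : b c (φ i) = 1 := if_pos ⟨j, hj, hbj⟩
    have := div_nonneg (he0 c (φ i)) (by positivity : 0 ≤ 4 * B)
    linarith
  have hei : e c (φ i) ≤ 4 * B := by
    have := hb0 c (φ i)
    have h : e c (φ i) / (4 * B) ≤ 1 := by linarith
    rwa [div_le_one (by positivity)] at h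
  -- A kept word has no bad partner in the whole code, so any confusion inside the subcode is
  -- already counted by `e`.
  refine le_trans (Finset.sum_le_sum fun z _ => mul_le_mul_of_nonneg_left ?_ (hw _ _)) hei
  split_ifs with h1 h2 h2
  · exact le_rfl
  · obtain ⟨j, hj, hjc⟩ := h1
    have hne : φ j ≠ φ i := fun h => hj (φ.injective h)
    exact absurd ⟨φ j, hne, hnb _ hne, hjc⟩ h2
  · exact zero_le_one
  · exact le_rfl

end Expurgation


/-! ### Error bound for codes of a fixed type -/

section Coding

variable {X Y : Type*} [Fintype X] [Fintype Y] [DecidableEq X] [DecidableEq Y] {n : ℕ}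

/-- The joint law `Q` gives no mass to transitions that the channel `W` forbids. -/
def Compatible (W : X → Y → ℝ) (Q : X × Y → ℝ) : Prop :=
  ∀ x y, W x y = 0 → Q (x, y) = 0

/-- The divergence `D(Q_{Y|X} ‖ W | Q_X)` of a joint law that is compatible with `W`. -/
noncomputable def channelDiv (W : X → Y → ℝ) (Q : X × Y → ℝ) : ℝ :=
  entropy (fstMarginal Q) - entropy Q - ∑ p, Q p * Real.log (W p.1 p.2)

/-- The joint type of three sequences. -/
noncomputable def tripleType (x x' : Fin n → X) (y : Fin n → Y) : X × X × Y → ℝ :=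
  empirical (fun k => (x k, x' k, y k))

lemma lawXX'_tripleType (x x' : Fin n → X) (y : Fin n → Y) :
    lawXX' (tripleType x x' y) = jointType x x' := by
  ext p
  simp only [lawXX', tripleType, jointType, empirical_eq_sum, ← Finset.sum_div]
  rw [Finset.sum_comm]
  simp [Prod.ext_iff, ite_and]

lemma lawXY_tripleType (x x' : Fin n → X) (y : Fin n → Y) :
    lawXY (tripleType x x' y) = jointType x y := by
  ext p
  simp only [lawXY, tripleType, jointType, empirical_eq_sum, ← Finset.sum_div]
  rw [Finset.sum_comm]
  simp [Prod.ext_iff, ite_and]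

lemma lawX'Y_tripleType (x x' : Fin n → X) (y : Fin n → Y) :
    lawX'Y (tripleType x x' y) = jointType x' y := by
  ext p
  simp only [lawX'Y, tripleType, jointType, empirical_eq_sum, ← Finset.sum_div]
  rw [Finset.sum_comm]
  simp [Prod.ext_iff, ite_and]

lemma lawX'YX_tripleType (x x' : Fin n → X) (y : Fin n → Y) :
    lawX'YX (tripleType x x' y) = jointType x' (fun k => (y k, x k)) := by
  ext ⟨a, b, c⟩
  simp only [lawX'YX, tripleType, jointType, empirical_eq_sum, Prod.mk.injEq]
  exact congrArg (· / (n : ℝ)) (Finset.sum_congr rfl fun k _ => if_congr (by tauto) rfl rfl)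

/-- The probability that the channel output has a given joint type with the input. -/
lemma sum_prob_jointType_le {W : X → Y → ℝ} (hW : ∀ x, W x ∈ stdSimplex ℝ Y)
    {Q : X × Y → ℝ} (hQ : Compatible W Q) (x : Fin n → X) :
    ∑ y ∈ Finset.univ.filter (fun y : Fin n → Y => jointType x y = Q), ∏ k, W (x k) (y k)
      ≤ Real.exp (-(n * channelDiv W Q)) := by
  have hval : ∀ y ∈ Finset.univ.filter (fun y : Fin n → Y => jointType x y = Q),
      ∏ k, W (x k) (y k) = Real.exp (n * ∑ p, Q p * Real.log (W p.1 p.2)) := by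
    intro y hy
    have hy : jointType x y = Q := by simpa using hy
    rw [prod_eq_exp (fun k => (x k, y k)) (fun p => W p.1 p.2)]
    · change Real.exp (n * ∑ p, jointType x y p * _) = _
      rw [hy]
    · intro k
      refine ((hW _).1 _).lt_of_ne' fun h0 => ?_
      have := jointType_pos x y k
      rw [hy, hQ _ _ h0] at this
      exact lt_irrefl _ this
  rw [Finset.sum_congr rfl hval, Finset.sum_const, nsmul_eq_mul]
  refine (mul_le_mul_of_nonneg_right (card_condTypeClass_le x Q) (Real.exp_nonneg _)).trans_eq ?_
  rw [← Real.exp_add, channelDiv]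
  congr 1
  ring

lemma prob_eq_zero_of_not_compatible {W : X → Y → ℝ} {x : Fin n → X} {y : Fin n → Y}
    (h : ¬ Compatible W (jointType x y)) : ∏ k, W (x k) (y k) = 0 := by
  simp only [Compatible, not_forall] at h
  obtain ⟨a, b, hab, hne⟩ := h
  obtain ⟨k, hk⟩ := exists_of_empirical_pos ((empirical_nonneg _ _).lt_of_ne' hne)
  simp only [Prod.mk.injEq] at hk
  exact Finset.prod_eq_zero (Finset.mem_univ k) (by rw [hk.1, hk.2, hab])

/-- Subadditivity of truncation lets the union bound be split over joint types, each keeping its own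
`|I - R|₊`. -/
lemma min_one_sum_le {ι : Type*} (s : Finset ι) (f : ι → ℝ) (hf : ∀ i, 0 ≤ f i) :
    min 1 (∑ i ∈ s, f i) ≤ ∑ i ∈ s, min 1 (f i) := by
  classical
  induction s using Finset.induction_on with
  | empty => simp
  | insert i s hi ih =>
    rw [Finset.sum_insert hi, Finset.sum_insert hi]
    have h1 : 0 ≤ ∑ j ∈ s, f j := Finset.sum_nonneg fun j _ => hf j
    have h2 := hf i
    have h3 : min 1 (f i + ∑ j ∈ s, f j) ≤ min 1 (f i) + min 1 (∑ j ∈ s, f j) := by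
      rcases min_cases 1 (f i) with h | h <;> rcases min_cases 1 (∑ j ∈ s, f j) with h' | h' <;>
        rcases min_cases 1 (f i + ∑ j ∈ s, f j) with h'' | h'' <;> linarith
    linarith

lemma card_subtype_filter_le {S : Type*} [Fintype S] {p : S → Prop} [Fintype {x // p x}]
    (r : {x // p x} → Prop) [DecidablePred r] (r' : S → Prop) [DecidablePred r']
    (h : ∀ t, r t → r' t.1) :
    (Finset.univ.filter r).card ≤ (Finset.univ.filter r').card :=
  Finset.card_le_card_of_injOn Subtype.val
    (fun t ht => by simpa using h t (by simpa using ht)) Subtype.val_injective.injOn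

/-- The sequences of the same type as `s`. -/
abbrev TypeClass (s : Fin n → X) := {t : Fin n → X // empirical t = empirical s}

-- A bad joint type `Q` has both marginals equal to the type of `s`, so its conditional class has at
-- most `exp (n (H - I(Q)))` members, with `I(Q) ≥ r`. There are polynomially many `Q`.
open Classical in
lemma card_bad_le (hn : 0 < n) (s : Fin n → X)
    (d : (X × X → ℝ) → ℝ) {r Δ : ℝ}
    (hd : ∀ Q ∈ stdSimplex ℝ (X × X), fstMarginal Q = empirical s →
      sndMarginal Q = empirical s → d Q < Δ → r ≤ mutualInfo Q) (t : TypeClass s) :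
    ((Finset.univ.filter fun t' : TypeClass s => d (jointType t.1 t'.1) < Δ).card : ℝ) ≤
      ((n : ℝ) + 1) ^ Fintype.card (X × X) * Real.exp (n * (entropy (empirical s) - r)) := by
  rw [Finset.card_eq_sum_card_fiberwise (f := fun t' : TypeClass s => jointType t.1 t'.1)
    (t := typesFinset (X × X) n) (fun t' _ => by exact_mod_cast empirical_mem_typesFinset _)]
  push_cast
  have h : ∀ Q ∈ typesFinset (X × X) n,
      (((Finset.univ.filter fun t' : TypeClass s => d (jointType t.1 t'.1) < Δ).filter
        fun t' => jointType t.1 t'.1 = Q).card : ℝ)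
        ≤ Real.exp (n * (entropy (empirical s) - r)) := by
    intro Q _
    rcases ((Finset.univ.filter fun t' : TypeClass s => d (jointType t.1 t'.1) < Δ).filter
        fun t' => jointType t.1 t'.1 = Q).eq_empty_or_nonempty with h | ⟨t', ht'⟩
    · rw [h]; simp [Real.exp_nonneg]
    simp only [Finset.mem_filter, Finset.mem_univ, true_and] at ht'
    obtain ⟨hlt, hQ⟩ := ht'
    have hfst : fstMarginal Q = empirical s := by rw [← hQ, fstMarginal_jointType, t.2]
    have hsnd : sndMarginal Q = empirical s := by rw [← hQ, sndMarginal_jointType, t'.2]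
    have hI := hd Q (by rw [← hQ]; exact empirical_mem_stdSimplex hn _) hfst hsnd (by rwa [← hQ])
    have h1 := card_condTypeClass_le t.1 Q
    rw [Finset.filter_filter]
    refine le_trans ?_ (h1.trans ?_)
    · exact Nat.cast_le.2 (card_subtype_filter_le _ _ fun t' ht' => ht'.2)
    · rw [Real.exp_le_exp]
      rw [mutualInfo, hfst, hsnd] at hI
      rw [hfst]
      exact mul_le_mul_of_nonneg_left (by linarith) (Nat.cast_nonneg _)
  refine (Finset.sum_le_sum h).trans ?_
  rw [Finset.sum_const, nsmul_eq_mul]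
  refine mul_le_mul_of_nonneg_right ?_ (Real.exp_nonneg _)
  exact_mod_cast card_typesFinset_le

open Classical in
/-- The contribution of one joint type to the truncated union bound. -/
lemma sum_prob_min_le (hn : 0 < n) {W : X → Y → ℝ} (hW : ∀ x, W x ∈ stdSimplex ℝ Y)
    (q : (X × Y → ℝ) → ℝ) (d : (X × X → ℝ) → ℝ) {Δ R a m L : ℝ} (s : Fin n → X)
    (hL : 1 ≤ L) (hs : Real.exp (n * entropy (empirical s)) ≤ L * Fintype.card (TypeClass s))
    (hm : m ≤ Real.exp (n * R))
    (hobj : ∀ V ∈ constraintSet (empirical s) q d Δ, Compatible W (lawXY V) →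
      a ≤ channelDiv W (lawXY V) + max (mutualInfo (lawX'YX V) - R) 0)
    (t : TypeClass s) (V : X × X × Y → ℝ) :
    ∑ y : Fin n → Y, (∏ k, W (t.1 k) (y k)) * min 1 (m *
      ((Finset.univ.filter fun t' : TypeClass s => (¬ d (jointType t.1 t'.1) < Δ ∧
        q (jointType t.1 y) ≤ q (jointType t'.1 y)) ∧ tripleType t.1 t'.1 y = V).card : ℝ) /
          Fintype.card (TypeClass s))
      ≤ L * Real.exp (-(n * a)) := by
  have hT : (0 : ℝ) < Fintype.card (TypeClass s) := by
    exact_mod_cast Fintype.card_pos_iff.2 (⟨⟨s, rfl⟩⟩ : Nonempty (TypeClass s))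
  have hw : ∀ y : Fin n → Y, 0 ≤ ∏ k, W (t.1 k) (y k) :=
    fun y => Finset.prod_nonneg fun k _ => (hW _).1 _
  set S : (Fin n → Y) → Finset (TypeClass s) := fun y => Finset.univ.filter fun t' : TypeClass s =>
    (¬ d (jointType t.1 t'.1) < Δ ∧ q (jointType t.1 y) ≤ q (jointType t'.1 y)) ∧
      tripleType t.1 t'.1 y = V with hS
  have hlaw : ∀ y, (S y).Nonempty → jointType t.1 y = lawXY V := by
    rintro y ⟨t', ht'⟩
    simp only [hS, Finset.mem_filter, Finset.mem_univ, true_and] at ht'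
    rw [← ht'.2, lawXY_tripleType]
  by_cases hne : ∃ y, (S y).Nonempty
  swap
  · push Not at hne
    have : ∀ y, (S y).card = 0 := fun y => by rw [hne y, Finset.card_empty]
    simp only [hS] at this
    simp only [this]
    simp
    positivity
  by_cases hC : Compatible W (lawXY V)
  swap
  · refine (Finset.sum_nonpos fun y _ => ?_).trans (by positivity)
    rcases (S y).eq_empty_or_nonempty with h0 | h0
    · rw [show Finset.univ.filter _ = (∅ : Finset (TypeClass s)) from h0]
      simp
    · rw [prob_eq_zero_of_not_compatible (by rwa [hlaw y h0]), zero_mul]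
  -- A single realization of `V` by a competitor puts `V` in the constraint set.
  obtain ⟨y₀, t₀, ht₀⟩ := hne
  simp only [hS, Finset.mem_filter, Finset.mem_univ, true_and, not_lt] at ht₀
  obtain ⟨⟨hd₀, hq₀⟩, hV₀⟩ := ht₀
  have hVmem : V ∈ constraintSet (empirical s) q d Δ := by
    rw [← hV₀]
    refine ⟨empirical_mem_stdSimplex hn _, ?_, ?_, ?_, ?_⟩
    · rw [lawXX'_tripleType, fstMarginal_jointType, t.2]
    · rw [lawXX'_tripleType, sndMarginal_jointType, t₀.2]
    · rwa [lawXY_tripleType, lawX'Y_tripleType]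
    · rwa [lawXX'_tripleType]
  have hfst : fstMarginal (lawX'YX V) = empirical s := by
    rw [← hV₀, lawX'YX_tripleType, fstMarginal_jointType, t₀.2]
  set I := mutualInfo (lawX'YX V) with hI
  -- If `I ≤ R` the truncation at `1` suffices; otherwise compare `exp (n R) exp (n (H - I))` with a
  -- class of at least `exp (n H) / L` words.
  have hmin : ∀ y, min 1 (m * ((S y).card : ℝ) / Fintype.card (TypeClass s))
      ≤ L * Real.exp (-(n * max (I - R) 0)) := by
    intro y
    rcases le_total (I - R) 0 with h0 | h0
    · rw [max_eq_right h0]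
      simpa using Or.inl hL
    · rw [max_eq_left h0]
      refine (min_le_right _ _).trans ?_
      rw [div_le_iff₀ hT]
      have h1 : ((S y).card : ℝ) ≤ Real.exp (n * (entropy (empirical s) - I)) := by
        rw [← hfst]
        refine le_trans ?_ (card_condTypeClass_le' (fun k => (y k, t.1 k)) (lawX'YX V))
        exact Nat.cast_le.2 (card_subtype_filter_le _ _ fun t' ht' => by
          rw [← ht'.2, lawX'YX_tripleType])
      calc m * ((S y).card : ℝ)
          ≤ Real.exp (n * R) * Real.exp (n * (entropy (empirical s) - I)) := by gcongr
        _ = Real.exp (n * entropy (empirical s)) * Real.exp (-(n * (I - R))) := by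
            rw [← Real.exp_add, ← Real.exp_add]; ring_nf
        _ ≤ (L * Fintype.card (TypeClass s)) * Real.exp (-(n * (I - R))) := by gcongr
        _ = _ := by ring
  calc _ ≤ ∑ y : Fin n → Y, if jointType t.1 y = lawXY V then
        (∏ k, W (t.1 k) (y k)) * (L * Real.exp (-(n * max (I - R) 0))) else 0 := by
        refine Finset.sum_le_sum fun y _ => ?_
        split_ifs with h
        · exact mul_le_mul_of_nonneg_left (hmin y) (hw y)
        · have h0 : S y = ∅ := Finset.not_nonempty_iff_eq_empty.1 fun h' => h (hlaw y h')
          rw [show Finset.univ.filter _ = (∅ : Finset (TypeClass s)) from h0]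
          simp
    _ = (∑ y ∈ Finset.univ.filter (fun y : Fin n → Y => jointType t.1 y = lawXY V),
        ∏ k, W (t.1 k) (y k)) * (L * Real.exp (-(n * max (I - R) 0))) := by
        rw [← Finset.sum_filter, Finset.sum_mul]
    _ ≤ Real.exp (-(n * channelDiv W (lawXY V))) * (L * Real.exp (-(n * max (I - R) 0))) :=
        mul_le_mul_of_nonneg_right (sum_prob_jointType_le hW hC t.1) (by positivity)
    _ = L * Real.exp (-(n * (channelDiv W (lawXY V) + max (I - R) 0))) := by
        rw [mul_left_comm, ← Real.exp_add]; ring_nf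
    _ ≤ L * Real.exp (-(n * a)) := by
        have := hobj V hVmem hC
        gcongr

/-- A code of words of the type of `s`, when the competing joint types have exponent at least `a`. -/
lemma exists_codebook (hn : 0 < n) {W : X → Y → ℝ} (hW : ∀ x, W x ∈ stdSimplex ℝ Y)
    (q : (X × Y → ℝ) → ℝ) (d : (X × X → ℝ) → ℝ) {Δ R δ a : ℝ} (s : Fin n → X) (M : ℕ)
    (hs : Real.exp (n * entropy (empirical s)) ≤ ((n : ℝ) + 1) ^ Fintype.card X *
      (Finset.univ.filter fun t : Fin n → X => empirical t = empirical s).card)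
    (hM : 2 * (M : ℝ) ≤ Real.exp (n * R))
    (hδ : ((n : ℝ) + 1) ^ (Fintype.card X + Fintype.card (X × X)) * Real.exp (-(n * δ)) ≤ 1 / 4)
    (hd : ∀ Q ∈ stdSimplex ℝ (X × X), fstMarginal Q = empirical s →
      sndMarginal Q = empirical s → d Q < Δ → R + δ ≤ mutualInfo Q)
    (hobj : ∀ V ∈ constraintSet (empirical s) q d Δ, Compatible W (lawXY V) →
      a ≤ channelDiv W (lawXY V) + max (mutualInfo (lawX'YX V) - R) 0) :
    ∃ c : Fin M → Fin n → X, errorProb W q c ≤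
      4 * (((n : ℝ) + 1) ^ (Fintype.card X + Fintype.card (X × X × Y)) * Real.exp (-(n * a))) := by
  classical
  set L : ℝ := ((n : ℝ) + 1) ^ Fintype.card X with hLdef
  have hL : 1 ≤ L := one_le_pow₀ (by linarith [(Nat.cast_nonneg n : (0 : ℝ) ≤ n)])
  have hcard : (Finset.univ.filter fun t : Fin n → X => empirical t = empirical s).card
      = Fintype.card (TypeClass s) := (Fintype.card_subtype _).symm
  rw [hcard] at hs
  have : Nonempty (TypeClass s) := ⟨⟨s, rfl⟩⟩
  have hT : (0 : ℝ) < Fintype.card (TypeClass s) := by exact_mod_cast Fintype.card_pos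
  set B : ℝ := ((n : ℝ) + 1) ^ (Fintype.card X + Fintype.card (X × X × Y)) * Real.exp (-(n * a))
    with hBdef
  have hB0 : 0 < B := by positivity
  obtain ⟨c, hc⟩ := exists_expurgated_code (T := TypeClass s) (Z := Fin n → Y)
    (fun t y => ∏ k, W (t.1 k) (y k)) (fun t y => Finset.prod_nonneg fun k _ => (hW _).1 _)
    (fun t t' => d (jointType t.1 t'.1) < Δ)
    (fun t t' y => q (jointType t.1 y) ≤ q (jointType t'.1 y)) M hB0
    (fun t => by
      rw [div_le_iff₀ hT]
      calc (2 * M : ℝ) * _ ≤ Real.exp (n * R) * (((n : ℝ) + 1) ^ Fintype.card (X × X) *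
            Real.exp (n * (entropy (empirical s) - (R + δ)))) :=
            mul_le_mul hM (card_bad_le hn s d hd t) (Nat.cast_nonneg _) (Real.exp_nonneg _)
        _ = ((n : ℝ) + 1) ^ Fintype.card (X × X) * Real.exp (-(n * δ)) *
            Real.exp (n * entropy (empirical s)) := by
            rw [mul_left_comm, mul_assoc, ← Real.exp_add, ← Real.exp_add]; ring_nf
        _ ≤ ((n : ℝ) + 1) ^ Fintype.card (X × X) * Real.exp (-(n * δ)) *
            (L * Fintype.card (TypeClass s)) := by gcongr
        _ = (((n : ℝ) + 1) ^ (Fintype.card X + Fintype.card (X × X)) * Real.exp (-(n * δ))) *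
            Fintype.card (TypeClass s) := by rw [pow_add]; ring
        _ ≤ _ := by gcongr)
    (fun t => by
      calc _ ≤ ∑ y : Fin n → Y, ∑ V ∈ typesFinset (X × X × Y) n,
            (∏ k, W (t.1 k) (y k)) * min 1 ((2 * M : ℝ) *
            ((Finset.univ.filter fun t' : TypeClass s => (¬ d (jointType t.1 t'.1) < Δ ∧
              q (jointType t.1 y) ≤ q (jointType t'.1 y)) ∧ tripleType t.1 t'.1 y = V).card : ℝ) /
              Fintype.card (TypeClass s)) := by
            refine Finset.sum_le_sum fun y _ => ?_
            rw [← Finset.mul_sum]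
            refine mul_le_mul_of_nonneg_left ?_ (Finset.prod_nonneg fun k _ => (hW _).1 _)
            refine le_trans (le_of_eq ?_) (min_one_sum_le _ _ fun V => by positivity)
            rw [Finset.card_eq_sum_card_fiberwise
              (f := fun t' : TypeClass s => tripleType t.1 t'.1 y)
              (t := typesFinset (X × X × Y) n)
              (fun t' _ => by exact_mod_cast empirical_mem_typesFinset _)]
            push_cast
            rw [Finset.mul_sum, Finset.sum_div]
            simp only [Finset.filter_filter]
        _ ≤ ∑ V ∈ typesFinset (X × X × Y) n, L * Real.exp (-(n * a)) := by
            rw [Finset.sum_comm]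
            exact Finset.sum_le_sum fun V _ =>
              sum_prob_min_le hn hW q d s hL hs hM hobj t V
        _ ≤ B := by
            rw [Finset.sum_const, nsmul_eq_mul, hBdef, pow_add, mul_comm (_ ^ _) (_ ^ _), mul_assoc]
            refine mul_le_mul_of_nonneg_right ?_ (by positivity)
            exact_mod_cast card_typesFinset_le)
  refine ⟨fun m => (c m).1, ?_⟩
  unfold errorProb
  have h1 : ∑ m, ∑ y : Fin n → Y, (∏ k, W ((c m).1 k) (y k)) *
      (if ∃ j, j ≠ m ∧ q (jointType (c m).1 y) ≤ q (jointType (c j).1 y) then (1 : ℝ) else 0)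
      ≤ M * (4 * B) := by
    refine (Finset.sum_le_sum fun m _ => hc m).trans_eq ?_
    simp
  -- For the empty code the prefactor `1 / 0` is `0`.
  rcases Nat.eq_zero_or_pos M with rfl | hMpos
  · simp only [Nat.cast_zero, div_zero, zero_mul]
    positivity
  · have hMr : (0 : ℝ) < M := by exact_mod_cast hMpos
    rw [one_div, inv_mul_le_iff₀ hMr]
    convert h1

end Coding


/-! ### Continuity and passage to the limit -/

section Limits

variable {X Y : Type*} [Fintype X] [Fintype Y]

/-- Compatibility rules out the value `⊤`. This replaces the extended-real divergence by a real
function that is continuous everywhere, as the compactness argument requires. -/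
lemma condDivergence_eq_channelDiv {W : X → Y → ℝ} {Q : X × Y → ℝ} (hQ : ∀ p, 0 ≤ Q p)
    (hC : Compatible W Q) :
    condDivergence (condMass Q) W (fstMarginal Q) = ((channelDiv W Q : ℝ) : EReal) := by
  rw [condDivergence, if_neg]
  · congr 1
    rw [channelDiv, ← neg_neg (entropy (fstMarginal Q)), ← sum_mul_log_fstMarginal, entropy,
      ← Finset.sum_neg_distrib, ← Finset.sum_sub_distrib, ← Finset.sum_sub_distrib,
      Fintype.sum_prod_type]
    refine Finset.sum_congr rfl fun x _ => ?_
    rw [Finset.mul_sum]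
    refine Finset.sum_congr rfl fun y _ => ?_
    rcases (hQ (x, y)).eq_or_lt with h0 | h0
    · simp [condMass, ← h0]
    · have hP := h0.trans_le (le_fstMarginal hQ x y)
      have hW : W x y ≠ 0 := fun h => h0.ne' (hC x y h)
      rw [condMass, Real.log_div (div_pos h0 hP).ne' hW, Real.log_div h0.ne' hP.ne',
        ← mul_assoc, mul_div_cancel₀ _ hP.ne', Real.negMulLog]
      ring
  · rintro ⟨x, y, -, hU, hW⟩
    simp [condMass, hC x y hW] at hU

lemma fstMarginal_lawXY (V : X × X × Y → ℝ) :
    fstMarginal (lawXY V) = fstMarginal (lawXX' V) := by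
  ext x
  exact Finset.sum_comm

lemma exponent_le {R Δ : ℝ} {P : X → ℝ} {W : X → Y → ℝ} {q : (X × Y → ℝ) → ℝ}
    {d : (X × X → ℝ) → ℝ} {V : X × X × Y → ℝ} (hV : V ∈ constraintSet P q d Δ)
    (hC : Compatible W (lawXY V)) :
    exponent R P W q d Δ ≤
      ((channelDiv W (lawXY V) + max (mutualInfo (lawX'YX V) - R) 0 : ℝ) : EReal) := by
  refine (iInf₂_le V hV).trans_eq ?_
  rw [← hV.2.1, ← fstMarginal_lawXY,
    condDivergence_eq_channelDiv (Q := lawXY V) (fun p => Finset.sum_nonneg fun _ _ => hV.1.1 _) hC,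
    EReal.coe_add]

lemma continuous_fstMarginal {A B : Type*} [Fintype B] :
    Continuous (fstMarginal : (A × B → ℝ) → A → ℝ) := by
  unfold fstMarginal; fun_prop

lemma continuous_sndMarginal {A B : Type*} [Fintype A] :
    Continuous (sndMarginal : (A × B → ℝ) → B → ℝ) := by
  unfold sndMarginal; fun_prop

lemma continuous_entropy {A : Type*} [Fintype A] : Continuous (entropy : (A → ℝ) → ℝ) :=
  continuous_finsetSum _ fun a _ => Real.continuous_negMulLog.comp (continuous_apply a)

lemma continuous_mutualInfo {A B : Type*} [Fintype A] [Fintype B] :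
    Continuous (mutualInfo : (A × B → ℝ) → ℝ) :=
  ((continuous_entropy.comp continuous_fstMarginal).add
    (continuous_entropy.comp continuous_sndMarginal)).sub continuous_entropy

lemma continuous_channelDiv (W : X → Y → ℝ) : Continuous (channelDiv W) :=
  ((continuous_entropy.comp continuous_fstMarginal).sub continuous_entropy).sub (by fun_prop)

lemma continuous_lawXX' : Continuous (lawXX' : (X × X × Y → ℝ) → X × X → ℝ) := by
  unfold lawXX'; fun_prop

lemma continuous_lawXY : Continuous (lawXY : (X × X × Y → ℝ) → X × Y → ℝ) := by
  unfold lawXY; fun_prop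

lemma continuous_lawX'Y : Continuous (lawX'Y : (X × X × Y → ℝ) → X × Y → ℝ) := by
  unfold lawX'Y; fun_prop

lemma continuous_lawX'YX : Continuous (lawX'YX : (X × X × Y → ℝ) → X × (Y × X) → ℝ) := by
  unfold lawX'YX; fun_prop

lemma lawXX'_mem {V : X × X × Y → ℝ} (hV : V ∈ stdSimplex ℝ (X × X × Y)) :
    lawXX' V ∈ stdSimplex ℝ (X × X) := by
  refine ⟨fun p => Finset.sum_nonneg fun _ _ => hV.1 _, ?_⟩
  rw [← hV.2]
  simp only [lawXX', Fintype.sum_prod_type]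

lemma lawXY_mem {V : X × X × Y → ℝ} (hV : V ∈ stdSimplex ℝ (X × X × Y)) :
    lawXY V ∈ stdSimplex ℝ (X × Y) := by
  refine ⟨fun p => Finset.sum_nonneg fun _ _ => hV.1 _, ?_⟩
  rw [← hV.2]
  simp only [lawXY, Fintype.sum_prod_type]
  exact Finset.sum_congr rfl fun x _ => Finset.sum_comm

lemma lawX'Y_mem {V : X × X × Y → ℝ} (hV : V ∈ stdSimplex ℝ (X × X × Y)) :
    lawX'Y V ∈ stdSimplex ℝ (X × Y) := by
  refine ⟨fun p => Finset.sum_nonneg fun _ _ => hV.1 _, ?_⟩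
  rw [← hV.2]
  simp only [lawX'Y, Fintype.sum_prod_type]
  rw [Finset.sum_comm]
  simp only [Finset.sum_comm (s := (Finset.univ : Finset Y))]
  rw [Finset.sum_comm]

/-- The image of `C` under `(f, g)` is compact, hence closed, and misses `(P, P)`; so it misses the
nearby diagonal points. In the uses, `f` and `g` are the two input marginals and `C` is a set of
violating laws. -/
lemma eventually_diag_notMem_image {E F : Type*} [TopologicalSpace E] [TopologicalSpace F]
    [T2Space F] {C : Set E} (hC : IsCompact C) {f g : E → F} (hf : Continuous f)
    (hg : Continuous g) {P : F} (hP : ∀ x ∈ C, f x = P → g x ≠ P) :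
    ∀ᶠ P' in nhds P, ∀ x ∈ C, f x = P' → g x ≠ P' := by
  have h1 : IsClosed ((fun x => (f x, g x)) '' C) := (hC.image (hf.prodMk hg)).isClosed
  have h2 : (P, P) ∈ ((fun x => (f x, g x)) '' C)ᶜ := by
    rintro ⟨x, hx, h⟩
    simp only [Prod.mk.injEq] at h
    exact hP x hx h.1 h.2
  have h3 : Tendsto (fun P' : F => (P', P')) (nhds P) (nhds (P, P)) :=
    (continuous_id.prodMk continuous_id).tendsto P
  filter_upwards [h3 (h1.isOpen_compl.mem_nhds h2)] with P' hP' x hx hfx hgx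
  exact hP' ⟨x, hx, by simp [hfx, hgx]⟩

/-- Every number below the exponent at `P` bounds the objective at the input laws near `P`. -/
lemma eventually_le_objective {R Δ a : ℝ} {P : X → ℝ} {W : X → Y → ℝ} {q : (X × Y → ℝ) → ℝ}
    {d : (X × X → ℝ) → ℝ} (hq : ContinuousOn q (stdSimplex ℝ (X × Y)))
    (hd : ContinuousOn d (stdSimplex ℝ (X × X))) (ha : (a : EReal) < exponent R P W q d Δ) :
    ∀ᶠ P' in nhds P, ∀ V ∈ constraintSet P' q d Δ, Compatible W (lawXY V) →
      a ≤ channelDiv W (lawXY V) + max (mutualInfo (lawX'YX V) - R) 0 := by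
  set K := stdSimplex ℝ (X × X × Y)
  have hK : IsCompact K := isCompact_stdSimplex ℝ (X × X × Y)
  have hobj : Continuous fun V : X × X × Y → ℝ =>
      channelDiv W (lawXY V) + max (mutualInfo (lawX'YX V) - R) 0 :=
    ((continuous_channelDiv W).comp continuous_lawXY).add
      (((continuous_mutualInfo.comp continuous_lawX'YX).sub continuous_const).max continuous_const)
  have hCc : IsClosed {V : X × X × Y → ℝ | Compatible W (lawXY V)} := by
    simp only [Compatible, Set.ofPred_forall]
    exact isClosed_iInter fun x => isClosed_iInter fun y => isClosed_iInter fun _ =>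
      isClosed_eq ((continuous_apply (x, y)).comp continuous_lawXY) continuous_const
  have h1 : IsClosed {V ∈ K | q (lawXY V) ≤ q (lawX'Y V)} :=
    hK.isClosed.isClosed_le (hq.comp continuous_lawXY.continuousOn fun V hV => lawXY_mem hV)
      (hq.comp continuous_lawX'Y.continuousOn fun V hV => lawX'Y_mem hV)
  have h2 : IsClosed {V ∈ K | Δ ≤ d (lawXX' V)} :=
    hK.isClosed.isClosed_le continuousOn_const
      (hd.comp continuous_lawXX'.continuousOn fun V hV => lawXX'_mem hV)
  -- The laws violating the bound, with both input marginals left free.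
  have hC : IsCompact ({V ∈ K | q (lawXY V) ≤ q (lawX'Y V)} ∩ {V ∈ K | Δ ≤ d (lawXX' V)} ∩
      {V | Compatible W (lawXY V)} ∩
      {V | channelDiv W (lawXY V) + max (mutualInfo (lawX'YX V) - R) 0 ≤ a}) :=
    hK.of_isClosed_subset (((h1.inter h2).inter hCc).inter (isClosed_le hobj continuous_const))
      fun V hV => hV.1.1.1.1
  have := eventually_diag_notMem_image hC (P := P)
    (continuous_fstMarginal.comp continuous_lawXX') (continuous_sndMarginal.comp continuous_lawXX')
    (by
      rintro V ⟨⟨⟨⟨hVK, hVq⟩, -, hVd⟩, hVC⟩, hVa⟩ hf hg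
      have := ha.trans_le (exponent_le (R := R) ⟨hVK, hf, hg, hVq, hVd⟩ hVC)
      exact absurd (EReal.coe_lt_coe_iff.1 this) (not_lt.2 hVa))
  filter_upwards [this] with P' hP' V hV hVC
  by_contra! hlt
  exact hP' V ⟨⟨⟨⟨hV.1, hV.2.2.2.1⟩, hV.1, hV.2.2.2.2⟩, hVC⟩, hlt.le⟩ hV.2.1 hV.2.2.1

/-- At `P` the margin is `2δ`. One `δ` is spent on moving to nearby types; the other later beats the
polynomial factors. -/
lemma eventually_le_mutualInfo {R δ Δ : ℝ} (hδ : 0 < δ) {P : X → ℝ} {d : (X × X → ℝ) → ℝ}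
    (hd : ContinuousOn d (stdSimplex ℝ (X × X)))
    (hrate : (R : EReal) ≤ minMutualInfo P d Δ - ((2 * δ : ℝ) : EReal)) :
    ∀ᶠ P' in nhds P, ∀ Q ∈ stdSimplex ℝ (X × X), fstMarginal Q = P' → sndMarginal Q = P' →
      d Q < Δ → R + δ ≤ mutualInfo Q := by
  have hK : IsCompact (stdSimplex ℝ (X × X)) := isCompact_stdSimplex ℝ (X × X)
  have hC : IsCompact ({Q ∈ stdSimplex ℝ (X × X) | d Q ≤ Δ} ∩ {Q | mutualInfo Q ≤ R + δ}) :=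
    hK.of_isClosed_subset ((hK.isClosed.isClosed_le hd continuousOn_const).inter
      (isClosed_le continuous_mutualInfo continuous_const)) fun Q hQ => hQ.1.1
  have := eventually_diag_notMem_image hC (P := P) continuous_fstMarginal continuous_sndMarginal
    (by
      rintro Q ⟨⟨hQK, hQd⟩, hQI⟩ hf hg
      have h1 : minMutualInfo P d Δ ≤ ((mutualInfo Q : ℝ) : EReal) :=
        iInf₂_le Q ⟨hQK, hf, hg, hQd⟩
      have h2 := hrate.trans (EReal.sub_le_sub h1 le_rfl)
      rw [← EReal.coe_sub, EReal.coe_le_coe_iff] at h2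
      have h3 : mutualInfo Q ≤ R + δ := hQI
      linarith)
  filter_upwards [this] with P' hP' Q hQ hf hg hlt
  by_contra! hI
  exact hP' Q ⟨⟨hQ, hlt.le⟩, hI.le⟩ hf hg

lemma eventually_pow_mul_exp_le (K : ℕ) {b : ℝ} (hb : 0 < b) :
    ∀ᶠ n : ℕ in atTop, ((n : ℝ) + 1) ^ K * Real.exp (-(n * b)) ≤ 1 / 4 :=
  (tendsto_pow_mul_exp_neg K hb).eventually_le_const (by norm_num)

/-- The rate loss `ε` pays for doubling the code before expurgation, and `R > 0` absorbs the
rounding. -/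
lemma eventually_two_mul_ceil_exp_le {R ε : ℝ} (hR : 0 < R) (hε : 0 < ε) :
    ∀ᶠ n : ℕ in atTop, 2 * (⌈Real.exp (n * (R - ε))⌉₊ : ℝ) ≤ Real.exp (n * R) := by
  filter_upwards [eventually_pow_mul_exp_le 0 hR, eventually_pow_mul_exp_le 0 hε] with n h1 h2
  rw [pow_zero, one_mul] at h1 h2
  have h3 := (Nat.ceil_lt_add_one (Real.exp_nonneg (n * (R - ε)))).le
  have h4 : Real.exp (n * (R - ε)) = Real.exp (n * R) * Real.exp (-(n * ε)) := by
    rw [← Real.exp_add]; ring_nf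
  have h5 : Real.exp (n * R) * Real.exp (-(n * R)) = 1 := by
    rw [← Real.exp_add]; simp
  nlinarith [Real.exp_pos (n * R)]

lemma le_neg_log_div {n : ℕ} (hn : 0 < n) {p a : ℝ} (h : p ≤ Real.exp (-(n * a))) :
    (a : EReal) ≤ -(ENNReal.log (ENNReal.ofReal p) / (n : EReal)) := by
  have h1 : ENNReal.log (ENNReal.ofReal p) ≤ ((-(n * a) : ℝ) : EReal) := by
    refine (ENNReal.log_monotone (ENNReal.ofReal_le_ofReal h)).trans_eq ?_
    rw [ENNReal.log_ofReal_of_pos (Real.exp_pos _), Real.log_exp]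
  have h2 := EReal.div_le_div_right_of_nonneg (c := (n : EReal)) (by positivity) h1
  rw [EReal.le_neg]
  refine h2.trans_eq ?_
  have hn' : (n : ℝ) ≠ 0 := by positivity
  rw [← EReal.coe_coe_eq_natCast, ← EReal.coe_div, ← EReal.coe_neg]
  congr 1
  field_simp

end Limits

end RGV

/-! ### The achievability theorem -/

theorem mainTheorem7 {X Y : Type*} [Fintype X] [Fintype Y] [DecidableEq X] [DecidableEq Y]
    (W : X → Y → ℝ) (hW : ∀ x, W x ∈ stdSimplex ℝ Y)
    (P : X → ℝ) (hP : P ∈ stdSimplex ℝ X)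
    (q : (X × Y → ℝ) → ℝ) (hq : ContinuousOn q (stdSimplex ℝ (X × Y)))
    (d : (X × X → ℝ) → ℝ) (hd : ContinuousOn d (stdSimplex ℝ (X × X)))
    (R δ Δ : ℝ) (hR : 0 < R) (hδ : 0 < δ)
    (hrate : (R : EReal) ≤ RGV.minMutualInfo P d Δ - ((2 * δ : ℝ) : EReal)) :
    RGV.IsAchievableExponent W q R (RGV.exponent R P W q d Δ) := by
  intro ε hε
  obtain ⟨s, hsP, hs⟩ := RGV.exists_seq_dominant_type hP
  have hX : Nonempty X := by
    by_contra h
    rw [not_nonempty_iff] at h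
    simpa using hP.2
  -- Optimal codebooks do not depend on the target `a`, so one sequence serves every `a` below the
  -- exponent.
  have hopt : ∀ n : ℕ, ∃ c : Fin ⌈Real.exp (n * (R - ε))⌉₊ → Fin n → X,
      ∀ c', RGV.errorProb W q c ≤ RGV.errorProb W q c' :=
    fun n => Finite.exists_min fun c => RGV.errorProb W q c
  choose c hc using hopt
  -- The slack `ε` in the exponent is given away; it is needed only in the rate.
  refine ⟨c, (EReal.sub_le_of_le_add (le_add_of_nonneg_right (by exact_mod_cast hε.le))).trans ?_⟩
  refine EReal.ge_of_forall_gt_iff_ge.1 fun a ha => ?_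
  -- The gap `a' - a` absorbs the polynomial factor and the constant `4`.
  obtain ⟨a', haa', ha'⟩ := EReal.lt_iff_exists_real_btwn.1 ha
  rw [EReal.coe_lt_coe_iff] at haa'
  refine le_liminf_of_le (by isBoundedDefault) ?_
  filter_upwards [eventually_gt_atTop 0, RGV.eventually_two_mul_ceil_exp_le hR hε,
    RGV.eventually_pow_mul_exp_le (Fintype.card X + Fintype.card (X × X)) hδ,
    hsP.eventually (RGV.eventually_le_mutualInfo hδ hd hrate),
    hsP.eventually (RGV.eventually_le_objective hq hd ha'),
    RGV.eventually_pow_mul_exp_le (Fintype.card X + Fintype.card (X × X × Y))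
      (sub_pos.2 haa')] with n hn hM hδn hI hobj hpoly
  obtain ⟨c', hc'⟩ := RGV.exists_codebook hn hW q d (s n) _ (hs n hn) hM hδn hI hobj
  refine RGV.le_neg_log_div hn ((hc n c').trans (hc'.trans ?_))
  rw [show -(n * a') = -(n * (a' - a)) + -(n * a) by ring, Real.exp_add]
  nlinarith [Real.exp_pos (-(n * a))]
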